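/- For $x\in\mathbb R^n$ let $x_{(1)}\le\dots\le x_{(n)}$ be the increasing arrangement of its components. For $x,y\in\mathbb R^n$: $y\succeq_{\mathrm m}x$ (majorization) means $\sum_{i=1}^n x_{(i)}=\sum_{i=1}^n y_{(i)}$ and $\sum_{i=1}^j x_{(i)}\ge\sum_{i=1}^j y_{(i)}$ for $j=1,\dots,n-1$; $y\succeq^{\mathrm w}x$ (supmajorization) means $\sum_{i=1}^j x_{(i)}\ge\sum_{i=1}^j y_{(i)}$ for $j=1,\dots,n$; $y\succeq_{\mathrm w}x$ (submajorization) means $\sum_{i=j}^n x_{(i)}\le\sum_{i=j}^n y_{(i)}$ for $j=1,\dots,n$. For random variables, $X\le_{\mathrm{st}}Y$ means $P(X\le t)\ge P(Y\le t)$ for all $t\in\mathbb R$; and $X\le_{\mathrm{lr}}Y$ means that $X$ and $Y$ have Lebesgue densities $f$ and $g$ such that $g(x)/f(x)\in[0,\infty]$ (with $c/0=\infty$ for $c>0$) is nondecreasing in $x$ on the set of $x$ where it is not of the form $0/0$. A density $f$ is log-concave if $f(\alpha x+(1-\alpha)y)\ge f(x)^\alpha f(y)^{1-\alpha}$ for all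 $x,y\in\mathbb R$, $\alpha\in[0,1]$. **Theorem.** Let $\mathbb R_+=[0,\infty)$. Let $X_1,\dots,X_n$ be independent nonnegative random variables with $$X_1\ge_{\mathrm{lr}}X_2\ge_{\mathrm{lr}}\cdots\ge_{\mathrm{lr}}X_n ,$$ and let $\phi,\psi:\mathbb R_+\to\mathbb R_+$ be continuous, strictly monotone functions that are twice continuously differentiable on $(0,\infty)$ and satisfy, for all $u,v>0$, $$\phi''(u)\le 0\qquad\text{and}\qquad \phi''(u)\,\psi''(v)\,\phi(u)\,\psi(v)\ge[\phi'(u)\,\psi'(v)]^2 .$$ Assume that for each $i$ the variable $X_i$ takes values in $\psi(\mathbb R_+)$ almost surely and $\psi^{-1}(X_i)$ has a log-concave density. Let $a_1,\dots,a_n,b_1,\dots,b_n\in\phi(\mathbb R_+)$. If $$(\phi^{-1}(a_1),\dots,\phi^{-1}(a_n))\succeq_{\mathrm m}(\phi^{-1}(b_1),\dots,\phi^{-1}(b_n)),$$ then $$\sum_{i=1}^n a_{(i)}X_i\le_{\mathrm{st}}\sum_{i=1}^n b_{(i)}X_i .$$ Moreover, if $\phi$ is increasing (respectively decreasing), the same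 conclusion holds when $\succeq_{\mathrm m}$ is replaced by $\succeq^{\mathrm w}$ (respectively $\succeq_{\mathrm w}$). -/

import Mathlib

open MeasureTheory ProbabilityTheory Set
open scoped NNReal ENNReal

namespace LinComb

/-- The increasing arrangement `x_(1) ≤ x_(2) ≤ ... ≤ x_(n)` of the components of `x`. -/
noncomputable def incr {n : ℕ} (x : Fin n → ℝ) : Fin n → ℝ := x ∘ Tuple.sort x

/-- `x` is majorized by `y`: the total sums agree, and for each `j < n` the sum of the `j` smallest
components of `x` is at least the sum of the `j` smallest components of `y`. -/
def MajorizedBy {n : ℕ} (x y : Fin n → ℝ) : Prop :=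
  (∑ i, incr x i = ∑ i, incr y i) ∧
    ∀ j : ℕ, j < n → ∑ i : Fin n with i.val < j, incr y i ≤ ∑ i : Fin n with i.val < j, incr x i

/-- `x` is weakly supmajorized by `y`: for each `j ≤ n` the sum of the `j` smallest components
of `x` is at least the sum of the `j` smallest components of `y`. -/
def WeaklySupmajorizedBy {n : ℕ} (x y : Fin n → ℝ) : Prop :=
  ∀ j : ℕ, j ≤ n → ∑ i : Fin n with i.val < j, incr y i ≤ ∑ i : Fin n with i.val < j, incr x i

/-- `x` is weakly submajorized by `y`: every sum of the largest components of `x` is at most the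
sum of equally many largest components of `y`. -/
def WeaklySubmajorizedBy {n : ℕ} (x y : Fin n → ℝ) : Prop :=
  ∀ j : Fin n, ∑ i : Fin n with j ≤ i, incr x i ≤ ∑ i : Fin n with j ≤ i, incr y i

section Orders

variable {Ω : Type*} [MeasurableSpace Ω]

/-- `f` is a (version of the) Lebesgue density of the law of the random variable `X` under `P`. -/
structure IsDensityOf (f : ℝ → ℝ≥0) (X : Ω → ℝ) (P : Measure Ω) : Prop where
  aemeasurable : AEMeasurable X P
  measurable : Measurable f
  map_eq : P.map X = volume.withDensity (fun x => (f x : ℝ≥0∞))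

/-- Log-concavity of a nonnegative function on the real line. -/
def LogConcave (f : ℝ → ℝ≥0) : Prop :=
  ∀ x y α : ℝ, 0 ≤ α → α ≤ 1 → f x ^ α * f y ^ (1 - α) ≤ f (α * x + (1 - α) * y)

/-- The random variable `X` has a log-concave density. -/
def HasLogConcaveDensity (X : Ω → ℝ) (P : Measure Ω) : Prop :=
  ∃ f : ℝ → ℝ≥0, IsDensityOf f X P ∧ LogConcave f

/-- The usual stochastic order `X ≤_st Y`: the distribution functions `F` of `X` and `G` of `Y`
satisfy `F t ≥ G t` for all `t`. -/
def StLE (X Y : Ω → ℝ) (P : Measure Ω) : Prop :=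
  ∀ t : ℝ, P {ω | Y ω ≤ t} ≤ P {ω | X ω ≤ t}

/-- The likelihood ratio order `X ≤_lr Y`: there are densities `f` of `X` and `g` of `Y` such that
`g / f` is increasing on the set where the ratio is well defined, i.e. not of the form `0 / 0`.
The ratio is taken in `[0, ∞]`, and `c / 0 = ∞` for `c > 0`. -/
def LrLE (X Y : Ω → ℝ) (P : Measure Ω) : Prop :=
  ∃ f g : ℝ → ℝ≥0, IsDensityOf f X P ∧ IsDensityOf g Y P ∧
    MonotoneOn (fun x => (g x : ℝ≥0∞) / (f x : ℝ≥0∞)) {x | ¬(f x = 0 ∧ g x = 0)}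

end Orders

/-- A function `[0, ∞) → [0, ∞)` (given by the restriction of `f : ℝ → ℝ`) that is strictly
monotone (increasing or decreasing), continuous, and twice continuously differentiable on the
interior `(0, ∞)`. -/
structure IsMonotoneTransform (f : ℝ → ℝ) : Prop where
  mapsTo : MapsTo f (Ici 0) (Ici 0)
  strictMonotone : StrictMonoOn f (Ici 0) ∨ StrictAntiOn f (Ici 0)
  continuousOn : ContinuousOn f (Ici 0)
  contDiffOn : ContDiffOn ℝ 2 f (Ioi 0)

/-- The inverse of a function that is injective on `[0, ∞)`. It is meaningful on the image
`f '' [0, ∞)`, and takes its values in `[0, ∞)` there. -/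
noncomputable def inv (f : ℝ → ℝ) : ℝ → ℝ := Function.invFunOn f (Ici 0)

end LinComb

/-! Fix `t`, put `Y i = inv ψ (X i)` and regard the tail probability of `∑ φ (α i) * ψ (Y i)` as a
function of `α ≥ 0`. The condition on second derivatives says that the Hessian of `φ u * ψ v` is
negative semidefinite, so this product is jointly concave (`mul_jointly_concave`). Hence convex
combinations of points of two tail sets lie in the tail set of the combined `α`. The law of `Y` is a
product of log-concave laws and satisfies Prékopa–Leindler, so the tail probability is quasi-concave
in `α` (`convex_setOf_le_measure_tailSet`).

The likelihood ratio order says that moving a larger weight to a larger variable raises the tail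
probability, so among the rearrangements of `a` the increasing one has the smallest tail
(`measure_lt_sum_swap_le`, `apply_incr_le_of_swap`). Every rearrangement of `inv φ ∘ a` therefore
lies in the convex superlevel set at that smallest value, and so does their convex hull.

Supmajorization makes the sorted vector `inv φ ∘ b` dominate a point of this hull
(`WeaklySupmajorizedBy.incr_mem`). Since `φ` increases and `X ≥ 0`, passing to the dominating vector
only raises the tail. Majorization is a special case, and the decreasing case is vacuous: a
nonnegative concave function on the half line cannot strictly decrease. -/

namespace LinComb

/-! ### The Prékopa–Leindler inequality -/

open scoped Pointwise in
/-- The one-dimensional Brunn–Minkowski inequality. -/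
lemma volume_add_volume_le {A B C : Set ℝ} (hA : MeasurableSet A) (hB : MeasurableSet B)
    (hA' : A.Nonempty) (hB' : B.Nonempty) (hC : A + B ⊆ C) :
    volume A + volume B ≤ volume C := by
  have compact_case : ∀ K L : Set ℝ, IsCompact K → IsCompact L → K.Nonempty → L.Nonempty →
      K ⊆ A → L ⊆ B → volume K + volume L ≤ volume C := by
    intro K L hK hL hKn hLn hKA hLB
    obtain ⟨a, haK, ha⟩ := hK.exists_isGreatest hKn
    obtain ⟨b, hbL, hb⟩ := hL.exists_isLeast hLn
    have h1 : volume (b +ᵥ K) = volume K := measure_vadd volume b K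
    have h2 : volume (a +ᵥ L) = volume L := measure_vadd volume a L
    have hm : MeasurableSet (a +ᵥ L) := (hL.vadd a).isClosed.measurableSet
    -- With `a = max K` and `b = min L`, the translate `b + K` lies left of `a + b` and `a + L` lies
    -- right of it.
    have h3 : (b +ᵥ K) ∩ (a +ᵥ L) ⊆ {a + b} := by
      rintro x ⟨⟨k, hk, rfl⟩, ⟨l, hl, hx⟩⟩
      have := ha hk
      have := hb hl
      simp only [vadd_eq_add, mem_singleton_iff] at hx ⊢
      linarith
    have h4 : volume ((b +ᵥ K) ∩ (a +ᵥ L)) = 0 := measure_mono_null h3 (by simp)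
    rw [← h1, ← h2, ← measure_union_add_inter _ hm, h4, add_zero]
    refine measure_mono (union_subset ?_ ?_)
    · rintro _ ⟨k, hk, rfl⟩
      exact hC ⟨k, hKA hk, b, hLB hbL, add_comm _ _⟩
    · rintro _ ⟨l, hl, rfl⟩
      exact hC ⟨a, hKA haK, l, hLB hl, rfl⟩
  have approx : ∀ S : Set ℝ, MeasurableSet S → ∀ r < volume S,
      ∃ K ⊆ S, IsCompact K ∧ K.Nonempty ∧ r < volume K := by
    intro S hS r hr
    obtain ⟨K, hKS, hK, hrK⟩ := hS.exists_lt_isCompact hr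
    refine ⟨K, hKS, hK, nonempty_iff_ne_empty.2 ?_, hrK⟩
    rintro rfl
    simp at hrK
  have approx' : ∀ S : Set ℝ, MeasurableSet S → ∀ r : ℝ≥0∞,
      (∀ K ⊆ S, IsCompact K → K.Nonempty → volume K ≤ r) → volume S ≤ r := by
    intro S hS r h
    refine le_of_not_gt fun hr => ?_
    obtain ⟨K, hKS, hK, hKn, hrK⟩ := approx S hS r hr
    exact (h K hKS hK hKn).not_gt hrK
  by_cases hCt : volume C = ∞
  · simp [hCt]
  obtain ⟨b, hb⟩ := hB'
  obtain ⟨a, ha⟩ := hA'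
  have hBt : volume B ≤ volume C := by
    rw [← measure_vadd volume a B]
    refine measure_mono ?_
    rintro _ ⟨l, hl, rfl⟩
    exact hC ⟨a, ha, l, hl, rfl⟩
  have hKB : ∀ K ⊆ A, IsCompact K → K.Nonempty → volume K + volume B ≤ volume C := by
    intro K hKA hK hKn
    have hKC : volume K ≤ volume C := by
      rw [← measure_vadd volume b K]
      refine measure_mono ?_
      rintro _ ⟨k, hk, rfl⟩
      exact hC ⟨k, hKA hk, b, hb, add_comm _ _⟩
    have hKt : volume K ≠ ∞ := ne_top_of_le_ne_top hCt hKC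
    have : volume B ≤ volume C - volume K := approx' B hB _ fun L hLB hL hLn =>
      ENNReal.le_sub_of_add_le_left hKt (compact_case K L hK hL hKn hLn hKA hLB)
    calc volume K + volume B ≤ volume K + (volume C - volume K) := by gcongr
      _ = volume C := add_tsub_cancel_of_le hKC
  have hBt' : volume B ≠ ∞ := ne_top_of_le_ne_top hCt hBt
  have : volume A ≤ volume C - volume B := approx' A hA _ fun K hKA hK hKn =>
    ENNReal.le_sub_of_add_le_right hBt' (hKB K hKA hK hKn)
  calc volume A + volume B ≤ (volume C - volume B) + volume B := by gcongr
    _ = volume C := tsub_add_cancel_of_le hBt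

open scoped Pointwise in
lemma volume_convexCombination_le {A B C : Set ℝ} (hA : MeasurableSet A) (hB : MeasurableSet B)
    (hA' : A.Nonempty) (hB' : B.Nonempty) {s t : ℝ} (hs : 0 < s) (ht : 0 < t)
    (hC : ∀ x ∈ A, ∀ y ∈ B, s * x + t * y ∈ C) :
    ENNReal.ofReal s * volume A + ENNReal.ofReal t * volume B ≤ volume C := by
  have h := volume_add_volume_le (C := C) (hA.const_smul₀ s) (hB.const_smul₀ t)
    (hA'.smul_set (a := s)) (hB'.smul_set (a := t)) (by
      rintro _ ⟨_, ⟨x, hx, rfl⟩, _, ⟨y, hy, rfl⟩, rfl⟩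
      exact hC x hx y hy)
  simpa [Measure.addHaar_smul, abs_of_pos hs, abs_of_pos ht] using h

/-- A measure on a real vector space satisfies the Prékopa–Leindler inequality. -/
def PrekopaLeindler {E : Type*} [AddCommGroup E] [Module ℝ E] [MeasurableSpace E]
    (μ : Measure E) : Prop :=
  ∀ s t : ℝ, 0 < s → 0 < t → s + t = 1 → ∀ f g h : E → ℝ≥0∞,
    Measurable f → Measurable g → Measurable h →
    (∀ x y, f x ^ s * g y ^ t ≤ h (s • x + t • y)) →
    (∫⁻ x, f x ∂μ) ^ s * (∫⁻ x, g x ∂μ) ^ t ≤ ∫⁻ x, h x ∂μ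

lemma lintegral_eq_setLIntegral_meas_lt_of_le_one {f : ℝ → ℝ≥0∞} (hf : Measurable f)
    (hf1 : ∀ x, f x ≤ 1) :
    ∫⁻ x, f x = ∫⁻ r in Ioo (0 : ℝ) 1, volume {x | ENNReal.ofReal r < f x} := by
  have hfin : ∀ x, f x ≠ ∞ := fun x => ne_top_of_le_ne_top ENNReal.one_ne_top (hf1 x)
  have h1 := lintegral_eq_lintegral_meas_lt (volume : Measure ℝ) (f := fun x => (f x).toReal)
    (Filter.Eventually.of_forall fun x => ENNReal.toReal_nonneg) hf.ennreal_toReal.aemeasurable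
  simp only [ENNReal.ofReal_toReal (hfin _)] at h1
  rw [h1]
  have h2 : ∀ r ∈ Ioi (0 : ℝ), volume {x | r < (f x).toReal} =
      (Ioo (0 : ℝ) 1).indicator (fun r => volume {x | ENNReal.ofReal r < f x}) r := by
    intro r hr
    by_cases hr1 : r < 1
    · rw [indicator_of_mem (show r ∈ Ioo (0 : ℝ) 1 from ⟨hr, hr1⟩)]
      congr 1
      ext x
      exact (ENNReal.ofReal_lt_iff_lt_toReal (le_of_lt hr) (hfin x)).symm
    · rw [indicator_of_notMem (fun h => hr1 h.2)]
      have : {x | r < (f x).toReal} = ∅ := by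
        ext x
        simp only [mem_ofPred_eq, mem_empty_iff_false, iff_false, not_lt]
        exact (ENNReal.toReal_mono ENNReal.one_ne_top (hf1 x)).trans (by simpa using hr1)
      simp [this]
  rw [setLIntegral_congr_fun measurableSet_Ioi h2, setLIntegral_indicator measurableSet_Ioo,
    inter_eq_left.2 Ioo_subset_Ioi_self]

lemma rpow_mul_rpow_le_convexCombination (a b : ℝ≥0∞) {s t : ℝ} (hs : 0 < s) (ht : 0 < t)
    (hst : s + t = 1) :
    a ^ s * b ^ t ≤ ENNReal.ofReal s * a + ENNReal.ofReal t * b := by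
  have hpq : (s⁻¹).HolderConjugate t⁻¹ := Real.holderConjugate_iff.2
    ⟨(one_lt_inv₀ hs).2 (by linarith), by simpa using hst⟩
  have h := ENNReal.young_inequality (a ^ s) (b ^ t) hpq
  rw [← ENNReal.rpow_mul, ← ENNReal.rpow_mul, mul_inv_cancel₀ hs.ne', mul_inv_cancel₀ ht.ne',
    ENNReal.rpow_one, ENNReal.rpow_one, ENNReal.ofReal_inv_of_pos hs,
    ENNReal.ofReal_inv_of_pos ht, div_eq_mul_inv, div_eq_mul_inv, inv_inv, inv_inv] at h
  rwa [mul_comm _ a, mul_comm _ b]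

lemma rpow_mul_rpow_self {r : ℝ≥0∞} (h0 : r ≠ 0) (h1 : r ≠ ∞) {s t : ℝ} (hst : s + t = 1) :
    r ^ s * r ^ t = r := by
  rw [← ENNReal.rpow_add _ _ h0 h1, hst, ENNReal.rpow_one]

/-- The hypothesis puts `s • {f > r} + t • {g > r}` inside `{h > r}`. Both suprema being 1, the
first two sets are nonempty for every `r < 1`, as Brunn–Minkowski requires. Integrating over `r`
gives the bound with the arithmetic mean, which dominates the geometric mean. -/
lemma rpow_lintegral_mul_le_of_normalized {s t : ℝ} (hs : 0 < s) (ht : 0 < t) (hst : s + t = 1)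
    {f g h : ℝ → ℝ≥0∞} (hf : Measurable f) (hg : Measurable g) (hh : Measurable h)
    (hf1 : ∀ x, f x ≤ 1) (hg1 : ∀ x, g x ≤ 1) (hh1 : ∀ x, h x ≤ 1)
    (hf' : ∀ r < 1, ∃ x, r < f x) (hg' : ∀ r < 1, ∃ x, r < g x)
    (hfgh : ∀ x y, f x ^ s * g y ^ t ≤ h (s • x + t • y)) :
    (∫⁻ x, f x) ^ s * (∫⁻ x, g x) ^ t ≤ ∫⁻ x, h x := by
  refine (rpow_mul_rpow_le_convexCombination _ _ hs ht hst).trans ?_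
  rw [lintegral_eq_setLIntegral_meas_lt_of_le_one hf hf1,
    lintegral_eq_setLIntegral_meas_lt_of_le_one hg hg1,
    lintegral_eq_setLIntegral_meas_lt_of_le_one hh hh1,
    ← lintegral_const_mul' _ _ ENNReal.ofReal_ne_top,
    ← lintegral_const_mul' _ _ ENNReal.ofReal_ne_top]
  -- Only superadditivity of the lower integral is needed, so measurability in `r` of the level-set
  -- volumes plays no role.
  refine (le_lintegral_add _ _).trans (setLIntegral_mono' measurableSet_Ioo fun r hr => ?_)
  have hr1 : ENNReal.ofReal r < 1 := by simpa using hr.2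
  refine volume_convexCombination_le (measurableSet_lt measurable_const hf)
    (measurableSet_lt measurable_const hg) (hf' _ hr1) (hg' _ hr1) hs ht fun x hx y hy => ?_
  simp only [mem_ofPred_eq] at hx hy ⊢
  refine lt_of_lt_of_le ?_ (hfgh x y)
  rw [← rpow_mul_rpow_self (r := ENNReal.ofReal r) (by simpa using hr.1) ENNReal.ofReal_ne_top hst]
  exact ENNReal.mul_lt_mul (ENNReal.rpow_lt_rpow hx hs) (ENNReal.rpow_lt_rpow hy ht)

lemma rpow_lintegral_mul_le_of_bounded {s t : ℝ} (hs : 0 < s) (ht : 0 < t) (hst : s + t = 1)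
    {f g h : ℝ → ℝ≥0∞} (hf : Measurable f) (hg : Measurable g) (hh : Measurable h)
    (hf1 : ⨆ x, f x ≠ ∞) (hg1 : ⨆ x, g x ≠ ∞)
    (hfgh : ∀ x y, f x ^ s * g y ^ t ≤ h (s • x + t • y)) :
    (∫⁻ x, f x) ^ s * (∫⁻ x, g x) ^ t ≤ ∫⁻ x, h x := by
  set M := ⨆ x, f x with hM
  set N := ⨆ x, g x with hN
  by_cases hM0 : M = 0
  · have : ∀ x, f x = 0 := fun x => le_zero_iff.1 ((le_iSup f x).trans hM0.le)
    simp [this, hs]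
  by_cases hN0 : N = 0
  · have : ∀ x, g x = 0 := fun x => le_zero_iff.1 ((le_iSup g x).trans hN0.le)
    simp [this, ht]
  set K := M ^ s * N ^ t with hK
  have hMs0 : M ^ s ≠ 0 := by simp [ENNReal.rpow_eq_zero_iff, hM0, hs.not_gt]
  have hNt0 : N ^ t ≠ 0 := by simp [ENNReal.rpow_eq_zero_iff, hN0, ht.not_gt]
  have hMst : M ^ s ≠ ∞ := ENNReal.rpow_ne_top_of_nonneg hs.le hf1
  have hNtt : N ^ t ≠ ∞ := ENNReal.rpow_ne_top_of_nonneg ht.le hg1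
  have hK0 : K ≠ 0 := mul_ne_zero hMs0 hNt0
  have hKt : K ≠ ∞ := ENNReal.mul_ne_top hMst hNtt
  have sup_div : ∀ (u : ℝ → ℝ≥0∞) (U : ℝ≥0∞), U = ⨆ x, u x → U ≠ 0 → U ≠ ∞ →
      (∀ x, u x / U ≤ 1) ∧ ∀ r < 1, ∃ x, r < u x / U := by
    intro u U hU hU0 hUt
    refine ⟨fun x => ENNReal.div_le_of_le_mul (by rw [one_mul, hU]; exact le_iSup u x),
      fun r hr => ?_⟩
    have : r < ⨆ x, u x / U := by
      rw [← ENNReal.iSup_div, ← hU, ENNReal.div_self hU0 hUt]; exact hr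
    exact lt_iSup_iff.1 this
  -- Capping `h / K` at 1 is harmless, because the product of the normalized `f` and `g` powers is
  -- at most 1.
  have key := rpow_lintegral_mul_le_of_normalized hs ht hst (f := fun x => f x / M)
    (g := fun x => g x / N) (h := fun x => min (h x / K) 1) (hf.div_const _) (hg.div_const _)
    ((hh.div_const _).min measurable_const) (sup_div f M hM hM0 hf1).1 (sup_div g N hN hN0 hg1).1
    (fun x => min_le_right _ _) (sup_div f M hM hM0 hf1).2 (sup_div g N hN hN0 hg1).2 (by
      intro x y
      refine le_min ?_ ?_
      · rw [ENNReal.div_rpow_of_nonneg _ _ hs.le, ENNReal.div_rpow_of_nonneg _ _ ht.le, hK,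
          ENNReal.le_div_iff_mul_le (Or.inl hK0) (Or.inl hKt)]
        refine le_trans (le_of_eq ?_) (hfgh x y)
        rw [mul_mul_mul_comm, ENNReal.div_mul_cancel hMs0 hMst, ENNReal.div_mul_cancel hNt0 hNtt]
      · exact mul_le_one' (ENNReal.rpow_le_one ((sup_div f M hM hM0 hf1).1 x) hs.le)
          (ENNReal.rpow_le_one ((sup_div g N hN hN0 hg1).1 y) ht.le))
  simp only [div_eq_mul_inv] at key
  rw [lintegral_mul_const _ hf, lintegral_mul_const _ hg] at key
  have key2 := key.trans (lintegral_mono fun x => min_le_left (h x * K⁻¹) 1)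
  rw [lintegral_mul_const _ hh, ENNReal.mul_rpow_of_nonneg _ _ hs.le,
    ENNReal.mul_rpow_of_nonneg _ _ ht.le, ENNReal.inv_rpow, ENNReal.inv_rpow, mul_mul_mul_comm,
    ← ENNReal.mul_inv (Or.inl hMs0) (Or.inl hMst), ← hK] at key2
  exact (ENNReal.mul_le_mul_iff_left (ENNReal.inv_ne_zero.2 hKt)
    (ENNReal.inv_ne_top.2 hK0)).1 key2

lemma lintegral_eq_iSup_min_natCast {f : ℝ → ℝ≥0∞} (hf : Measurable f) :
    ∫⁻ x, f x = ⨆ n : ℕ, ∫⁻ x, min (f x) n := by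
  rw [← lintegral_iSup (fun n => hf.min measurable_const)
    (fun n m hnm x => min_le_min_left _ (by exact_mod_cast hnm))]
  refine lintegral_congr fun x => ?_
  rw [← inf_iSup_eq, ENNReal.iSup_natCast, inf_top_eq]

lemma iSup_rpow_of_pos {ι : Sort*} (u : ι → ℝ≥0∞) {s : ℝ} (hs : 0 < s) :
    (⨆ i, u i) ^ s = ⨆ i, u i ^ s :=
  (ENNReal.orderIsoRpow s hs).map_iSup u

/-- The one-dimensional Prékopa–Leindler inequality. -/
theorem prekopaLeindler_volume : PrekopaLeindler (volume : Measure ℝ) := by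
  intro s t hs ht hst f g h hf hg hh hfgh
  rw [lintegral_eq_iSup_min_natCast hf, lintegral_eq_iSup_min_natCast hg, iSup_rpow_of_pos _ hs,
    iSup_rpow_of_pos _ ht, ENNReal.iSup_mul]
  refine iSup_le fun n => ?_
  rw [ENNReal.mul_iSup]
  refine iSup_le fun m => ?_
  have bdd : ∀ (u : ℝ → ℝ≥0∞) (k : ℕ), ⨆ x, min (u x) k ≠ ∞ := fun u k =>
    ne_top_of_le_ne_top (ENNReal.natCast_ne_top k) (iSup_le fun x => min_le_right _ _)
  refine rpow_lintegral_mul_le_of_bounded hs ht hst (hf.min measurable_const)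
    (hg.min measurable_const) hh (bdd f n) (bdd g m) fun x y => (hfgh x y).trans' ?_
  gcongr <;> exact min_le_left _ _

theorem PrekopaLeindler.withDensity {μ : Measure ℝ} (hμ : PrekopaLeindler μ) {ρ : ℝ → ℝ≥0}
    (hρm : Measurable ρ) (hρ : LogConcave ρ) :
    PrekopaLeindler (μ.withDensity fun x => (ρ x : ℝ≥0∞)) := by
  intro s t hs ht hst f g h hf hg hh hfgh
  have hρm' := hρm.coe_nnreal_ennreal
  rw [lintegral_withDensity_eq_lintegral_mul _ hρm' hf,
    lintegral_withDensity_eq_lintegral_mul _ hρm' hg,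
    lintegral_withDensity_eq_lintegral_mul _ hρm' hh]
  refine hμ s t hs ht hst _ _ _ (hρm'.mul hf) (hρm'.mul hg) (hρm'.mul hh) fun x y => ?_
  simp only [Pi.mul_apply]
  rw [ENNReal.mul_rpow_of_nonneg _ _ hs.le, ENNReal.mul_rpow_of_nonneg _ _ ht.le,
    mul_mul_mul_comm]
  refine mul_le_mul' ?_ (hfgh x y)
  have := hρ x y s hs.le (by linarith)
  rw [show 1 - s = t by linarith] at this
  rw [← ENNReal.coe_rpow_of_nonneg _ hs.le, ← ENNReal.coe_rpow_of_nonneg _ ht.le]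
  exact_mod_cast this

/-- By Tonelli: the inequality for `ν` on fibres is exactly the hypothesis needed to apply the
inequality for `μ` to the partial integrals. -/
theorem PrekopaLeindler.prod {E F : Type*} [AddCommGroup E] [Module ℝ E] [MeasurableSpace E]
    [AddCommGroup F] [Module ℝ F] [MeasurableSpace F] {μ : Measure E} {ν : Measure F} [SFinite ν]
    (hμ : PrekopaLeindler μ) (hν : PrekopaLeindler ν) : PrekopaLeindler (μ.prod ν) := by
  intro s t hs ht hst f g h hf hg hh hfgh
  rw [lintegral_prod _ hf.aemeasurable, lintegral_prod _ hg.aemeasurable,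
    lintegral_prod _ hh.aemeasurable]
  refine hμ s t hs ht hst _ _ _ hf.lintegral_prod_right' hg.lintegral_prod_right'
    hh.lintegral_prod_right' fun x x' => ?_
  exact hν s t hs ht hst _ _ _ (hf.comp measurable_prodMk_left) (hg.comp measurable_prodMk_left)
    (hh.comp measurable_prodMk_left) fun y y' => hfgh (x, y) (x', y')

theorem PrekopaLeindler.map {E F : Type*} [AddCommGroup E] [Module ℝ E] [MeasurableSpace E]
    [AddCommGroup F] [Module ℝ F] [MeasurableSpace F] {μ : Measure E}
    (hμ : PrekopaLeindler μ) (e : E →ₗ[ℝ] F) (he : Measurable e) : PrekopaLeindler (μ.map e) := by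
  intro s t hs ht hst f g h hf hg hh hfgh
  rw [lintegral_map hf he, lintegral_map hg he, lintegral_map hh he]
  refine hμ s t hs ht hst _ _ _ (hf.comp he) (hg.comp he) (hh.comp he) fun x y => ?_
  simpa using hfgh (e x) (e y)

theorem PrekopaLeindler.pi {n : ℕ} {μ : Fin n → Measure ℝ} [∀ i, SigmaFinite (μ i)]
    (hμ : ∀ i, PrekopaLeindler (μ i)) : PrekopaLeindler (Measure.pi μ) := by
  induction n with
  | zero =>
    intro s t hs ht hst f g h hf hg hh hfgh
    rw [Measure.pi_of_empty μ, lintegral_dirac, lintegral_dirac, lintegral_dirac]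
    convert hfgh _ _ using 2
  | succ n ih =>
    have h1 := (measurePreserving_piFinSuccAbove μ 0).symm
    rw [← h1.map_eq]
    let e : ℝ × (Fin n → ℝ) →ₗ[ℝ] (Fin (n + 1) → ℝ) :=
      { toFun := (MeasurableEquiv.piFinSuccAbove (fun _ => ℝ) 0).symm
        map_add' := fun x y => by
          ext i
          refine Fin.cases ?_ (fun j => ?_) i <;> simp [MeasurableEquiv.piFinSuccAbove]
        map_smul' := fun c x => by
          ext i
          refine Fin.cases ?_ (fun j => ?_) i <;> simp [MeasurableEquiv.piFinSuccAbove] }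
    exact ((hμ 0).prod (ih fun i => hμ _)).map e h1.measurable

/-! ### Transforms of the half line and joint concavity of their product -/

namespace IsMonotoneTransform

variable {φ ψ : ℝ → ℝ}

lemma hasDerivAt (hφ : IsMonotoneTransform φ) {u : ℝ} (hu : 0 < u) :
    HasDerivAt φ (deriv φ u) u :=
  ((hφ.contDiffOn.contDiffAt (Ioi_mem_nhds hu)).differentiableAt (by norm_num)).hasDerivAt

lemma hasDerivAt_deriv (hφ : IsMonotoneTransform φ) {u : ℝ} (hu : 0 < u) :
    HasDerivAt (deriv φ) (deriv (deriv φ) u) u := by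
  have h : ContDiffOn ℝ (1 + 1) φ (Ioi 0) := by
    have := hφ.contDiffOn
    rwa [show (2 : WithTop ℕ∞) = 1 + 1 from by norm_num] at this
  have h2 := ((contDiffOn_succ_iff_deriv_of_isOpen isOpen_Ioi).1 h).2.2
  exact ((h2.contDiffAt (Ioi_mem_nhds hu)).differentiableAt (by norm_num)).hasDerivAt

lemma nonneg (hφ : IsMonotoneTransform φ) {u : ℝ} (hu : 0 ≤ u) : 0 ≤ φ u := hφ.mapsTo hu

lemma pos (hφ : IsMonotoneTransform φ) {u : ℝ} (hu : 0 < u) : 0 < φ u := by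
  rcases hφ.strictMonotone with h | h
  · exact (hφ.nonneg le_rfl).trans_lt (h self_mem_Ici hu.le hu)
  · have h1 : (0 : ℝ) ≤ u + 1 := by linarith
    exact (hφ.nonneg h1).trans_lt (h hu.le h1 (by linarith))

lemma injOn (hφ : IsMonotoneTransform φ) : InjOn φ (Ici 0) :=
  hφ.strictMonotone.elim StrictMonoOn.injOn StrictAntiOn.injOn

lemma exists_deriv_ne_zero (hφ : IsMonotoneTransform φ) : ∃ u, 0 < u ∧ deriv φ u ≠ 0 := by
  obtain ⟨c, hc, h⟩ := exists_deriv_eq_slope φ (show (1 : ℝ) < 2 by norm_num)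
    (hφ.continuousOn.mono fun x hx => le_trans (by norm_num) hx.1)
    (fun x hx => (hφ.hasDerivAt (by linarith [hx.1])).differentiableAt.differentiableWithinAt)
  refine ⟨c, by linarith [hc.1], ?_⟩
  rw [h]
  have : φ 2 ≠ φ 1 := fun h => by
    have := hφ.injOn (by norm_num) (by norm_num) h
    norm_num at this
  exact div_ne_zero (sub_ne_zero.2 this) (by norm_num)

lemma strictMonoOn_of_deriv2_nonpos (hφ : IsMonotoneTransform φ)
    (hφ'' : ∀ u, 0 < u → deriv (deriv φ) u ≤ 0) : StrictMonoOn φ (Ici 0) := by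
  refine hφ.strictMonotone.resolve_right fun h => ?_
  have hconc : ConcaveOn ℝ (Ici 0) φ := by
    refine concaveOn_of_hasDerivWithinAt2_nonpos (f' := deriv φ) (f'' := deriv (deriv φ))
      (convex_Ici 0) hφ.continuousOn ?_ ?_ ?_ <;> intro x hx <;> rw [interior_Ici] at hx
    · exact (hφ.hasDerivAt hx).hasDerivWithinAt
    · exact (hφ.hasDerivAt_deriv hx).hasDerivWithinAt
    · exact hφ'' x hx
  have h01 : φ 1 < φ 0 := h self_mem_Ici (by norm_num) one_pos
  -- At `N` the chord bound would make `φ` negative: concavity on `0, 1, N` and `φ N ≥ 0` give `N *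
  -- (φ 0 - φ 1) ≤ φ 0`.
  obtain ⟨N, hN⟩ := exists_nat_gt (φ 0 / (φ 0 - φ 1))
  have hd : 0 < φ 0 - φ 1 := sub_pos.2 h01
  have h0 : 0 < φ 0 := (hφ.nonneg zero_le_one).trans_lt h01
  have hN0 : (0 : ℝ) < N := lt_trans (div_pos h0 hd) hN
  have hN1 : (1 : ℝ) ≤ N := by exact_mod_cast Nat.one_le_iff_ne_zero.2 (by rintro rfl; simp at hN0)
  have h2 := hconc.2 (show (0 : ℝ) ∈ Ici 0 by simp) (show (N : ℝ) ∈ Ici 0 from hN0.le)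
    (show (0 : ℝ) ≤ 1 - 1 / N by
      rw [sub_nonneg, div_le_one hN0]; exact hN1) (show (0 : ℝ) ≤ 1 / N by positivity) (by ring)
  have h3 : 0 ≤ φ N := hφ.nonneg hN0.le
  simp only [smul_eq_mul, mul_zero, zero_add, one_div, inv_mul_cancel₀ hN0.ne'] at h2
  rw [div_lt_iff₀ hd] at hN
  have h4 : φ 0 - φ 1 ≤ (N : ℝ)⁻¹ * φ 0 := by nlinarith [mul_nonneg (inv_nonneg.2 hN0.le) h3]
  have h5 : N * (φ 0 - φ 1) ≤ φ 0 := by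
    calc N * (φ 0 - φ 1) ≤ N * ((N : ℝ)⁻¹ * φ 0) := by gcongr
      _ = φ 0 := by field_simp
  linarith

/-- At a pair of points where `φ'` and `ψ'` do not vanish, the condition forces `φ'' < 0` at `u₀`. A
positive `ψ''` at `v` would then make its right side negative at `(u₀, v)`. -/
lemma deriv2_nonpos_of_det (hφ : IsMonotoneTransform φ) (hψ : IsMonotoneTransform ψ)
    (hφ'' : ∀ u, 0 < u → deriv (deriv φ) u ≤ 0)
    (hφψ : ∀ u v : ℝ, 0 < u → 0 < v →
      (deriv φ u * deriv ψ v) ^ 2 ≤ deriv (deriv φ) u * deriv (deriv ψ) v * φ u * ψ v)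
    {v : ℝ} (hv : 0 < v) : deriv (deriv ψ) v ≤ 0 := by
  obtain ⟨u₀, hu₀, hu₀'⟩ := hφ.exists_deriv_ne_zero
  obtain ⟨v₀, hv₀, hv₀'⟩ := hψ.exists_deriv_ne_zero
  have h1 : 0 < (deriv φ u₀ * deriv ψ v₀) ^ 2 := by positivity
  have h2 : deriv (deriv φ) u₀ ≠ 0 := fun h => by
    have := hφψ u₀ v₀ hu₀ hv₀
    rw [h] at this
    simp only [zero_mul] at this
    linarith
  have h3 : deriv (deriv φ) u₀ < 0 := lt_of_le_of_ne (hφ'' u₀ hu₀) h2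
  by_contra! h4
  have h5 := (sq_nonneg _).trans (hφψ u₀ v hu₀ hv)
  have h6 : deriv (deriv φ) u₀ * deriv (deriv ψ) v * φ u₀ * ψ v < 0 :=
    mul_neg_of_neg_of_pos (mul_neg_of_neg_of_pos (mul_neg_of_neg_of_pos h3 h4) (hφ.pos hu₀))
      (hψ.pos hv)
  linarith

end IsMonotoneTransform

lemma quadratic_nonpos {a b c : ℝ} (ha : a ≤ 0) (hc : c ≤ 0) (h : b ^ 2 ≤ a * c) (x y : ℝ) :
    a * x ^ 2 + 2 * b * x * y + c * y ^ 2 ≤ 0 := by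
  rcases ha.lt_or_eq with ha | rfl
  · have h1 : 0 ≤ a * (a * x ^ 2 + 2 * b * x * y + c * y ^ 2) := by
      have : a * (a * x ^ 2 + 2 * b * x * y + c * y ^ 2) =
        (a * x + b * y) ^ 2 + (a * c - b ^ 2) * y ^ 2 := by ring
      rw [this]
      have : 0 ≤ a * c - b ^ 2 := by linarith
      positivity
    exact nonpos_of_mul_nonneg_right h1 ha
  · have : b = 0 := by nlinarith [sq_nonneg b]
    subst this
    nlinarith [mul_nonneg (neg_nonneg.2 hc) (sq_nonneg y)]

/-- Restricted to the segment, the product has as second derivative the quadratic form with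
coefficients `φ'' ψ`, `φ' ψ'`, `φ ψ''`; `hφψ` is its determinant condition. -/
lemma mul_jointly_concave_of_pos {φ ψ : ℝ → ℝ} (hφ : IsMonotoneTransform φ)
    (hψ : IsMonotoneTransform ψ)
    (hφ'' : ∀ u, 0 < u → deriv (deriv φ) u ≤ 0)
    (hφψ : ∀ u v : ℝ, 0 < u → 0 < v →
      (deriv φ u * deriv ψ v) ^ 2 ≤ deriv (deriv φ) u * deriv (deriv ψ) v * φ u * ψ v)
    {u u' v v' s t : ℝ} (hu : 0 < u) (hu' : 0 < u') (hv : 0 < v) (hv' : 0 < v')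
    (hs : 0 ≤ s) (ht : 0 ≤ t) (hst : s + t = 1) :
    s * (φ u * ψ v) + t * (φ u' * ψ v') ≤ φ (s * u + t * u') * ψ (s * v + t * v') := by
  have segment_pos : ∀ a b : ℝ, 0 < a → 0 < b → ∀ r ∈ Icc (0 : ℝ) 1, 0 < a + r * (b - a) := by
    intro a b ha hb r hr
    rw [show a + r * (b - a) = (1 - r) * a + r * b by ring]
    rcases hr.1.eq_or_lt with rfl | h
    · simpa using ha
    · have := mul_nonneg (sub_nonneg.2 hr.2) ha.le
      have := mul_pos h hb
      linarith
  set p : ℝ → ℝ := fun r => u + r * (u' - u) with hp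
  set q : ℝ → ℝ := fun r => v + r * (v' - v) with hq
  have hp' : ∀ r, HasDerivAt p (u' - u) r := fun r => by
    have h := ((hasDerivAt_id r).mul_const (u' - u)).const_add u
    rwa [one_mul] at h
  have hq' : ∀ r, HasDerivAt q (v' - v) r := fun r => by
    have h := ((hasDerivAt_id r).mul_const (v' - v)).const_add v
    rwa [one_mul] at h
  have hpp := segment_pos u u' hu hu'
  have hqp := segment_pos v v' hv hv'
  have hφp : ∀ r ∈ Icc (0 : ℝ) 1, HasDerivAt (fun r => φ (p r)) (deriv φ (p r) * (u' - u)) r :=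
    fun r hr => (hφ.hasDerivAt (hpp r hr)).comp r (hp' r)
  have hψq : ∀ r ∈ Icc (0 : ℝ) 1, HasDerivAt (fun r => ψ (q r)) (deriv ψ (q r) * (v' - v)) r :=
    fun r hr => (hψ.hasDerivAt (hqp r hr)).comp r (hq' r)
  have hφp' : ∀ r ∈ Icc (0 : ℝ) 1,
      HasDerivAt (fun r => deriv φ (p r)) (deriv (deriv φ) (p r) * (u' - u)) r :=
    fun r hr => HasDerivAt.comp (h₂ := deriv φ) r (hφ.hasDerivAt_deriv (hpp r hr)) (hp' r)
  have hψq' : ∀ r ∈ Icc (0 : ℝ) 1,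
      HasDerivAt (fun r => deriv ψ (q r)) (deriv (deriv ψ) (q r) * (v' - v)) r :=
    fun r hr => HasDerivAt.comp (h₂ := deriv ψ) r (hψ.hasDerivAt_deriv (hqp r hr)) (hq' r)
  have hconc : ConcaveOn ℝ (Icc 0 1) (fun r => φ (p r) * ψ (q r)) := by
    refine concaveOn_of_hasDerivWithinAt2_nonpos
      (f'' := fun r => deriv (deriv φ) (p r) * (u' - u) * (u' - u) * ψ (q r) +
        deriv φ (p r) * (u' - u) * (deriv ψ (q r) * (v' - v)) +
        (deriv φ (p r) * (u' - u) * (deriv ψ (q r) * (v' - v)) +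
        φ (p r) * (deriv (deriv ψ) (q r) * (v' - v) * (v' - v)))) (convex_Icc 0 1)
      (fun r hr => ((hφp r hr).mul (hψq r hr)).continuousAt.continuousWithinAt)
      (fun r hr => ((hφp r (interior_subset hr)).mul (hψq r (interior_subset hr))).hasDerivWithinAt)
      (fun r hr => ?_) (fun r hr => ?_)
    · have hr := interior_subset hr
      exact ((((hφp' r hr).mul_const _).mul (hψq r hr)).add
        ((hφp r hr).mul ((hψq' r hr).mul_const _))).hasDerivWithinAt
    · have hr := interior_subset hr
      have hP := hpp r hr
      have hQ := hqp r hr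
      refine le_trans (le_of_eq ?_) (quadratic_nonpos
        (a := deriv (deriv φ) (p r) * ψ (q r)) (b := deriv φ (p r) * deriv ψ (q r))
        (c := φ (p r) * deriv (deriv ψ) (q r))
        (mul_nonpos_of_nonpos_of_nonneg (hφ'' _ hP) (hψ.pos hQ).le)
        (mul_nonpos_of_nonneg_of_nonpos (hφ.pos hP).le (hφ.deriv2_nonpos_of_det hψ hφ'' hφψ hQ))
        (by linarith [hφψ _ _ hP hQ]) (u' - u) (v' - v))
      ring
  have h := hconc.2 (show (0 : ℝ) ∈ Icc (0 : ℝ) 1 by simp) (show (1 : ℝ) ∈ Icc (0 : ℝ) 1 by simp)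
    hs ht hst
  obtain rfl : s = 1 - t := by linarith
  simp only [hp, hq, smul_eq_mul, zero_mul, add_zero, one_mul, mul_zero, mul_one, zero_add,
    add_sub_cancel] at h
  rwa [show (1 - t) * u + t * u' = u + t * (u' - u) by ring,
    show (1 - t) * v + t * v' = v + t * (v' - v) by ring]

/-- The product `φ u * ψ v` is jointly concave on the closed quadrant. -/
lemma mul_jointly_concave {φ ψ : ℝ → ℝ} (hφ : IsMonotoneTransform φ)
    (hψ : IsMonotoneTransform ψ)
    (hφ'' : ∀ u, 0 < u → deriv (deriv φ) u ≤ 0)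
    (hφψ : ∀ u v : ℝ, 0 < u → 0 < v →
      (deriv φ u * deriv ψ v) ^ 2 ≤ deriv (deriv φ) u * deriv (deriv ψ) v * φ u * ψ v)
    {u u' v v' s t : ℝ} (hu : 0 ≤ u) (hu' : 0 ≤ u') (hv : 0 ≤ v) (hv' : 0 ≤ v')
    (hs : 0 ≤ s) (ht : 0 ≤ t) (hst : s + t = 1) :
    s * (φ u * ψ v) + t * (φ u' * ψ v') ≤ φ (s * u + t * u') * ψ (s * v + t * v') := by
  -- Boundary points are reached by shifting every argument by `ε` and letting `ε → 0+`; as `s + t =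
  -- 1`, convex combinations shift by `ε` too.
  have shift : ∀ {f : ℝ → ℝ}, IsMonotoneTransform f → ∀ {x : ℝ}, 0 ≤ x →
      Filter.Tendsto (fun ε => f (x + ε)) (nhdsWithin 0 (Ioi 0)) (nhds (f x)) := by
    intro f hf x hx
    refine (hf.continuousOn x hx).tendsto.comp (tendsto_nhdsWithin_iff.2 ⟨?_, ?_⟩)
    · have : Filter.Tendsto (fun ε : ℝ => x + ε) (nhds 0) (nhds (x + 0)) :=
        (continuous_const.add continuous_id).tendsto 0
      rw [add_zero] at this
      exact this.mono_left nhdsWithin_le_nhds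
    · filter_upwards [self_mem_nhdsWithin] with ε hε
      exact add_nonneg hx (le_of_lt hε)
  have hp : 0 ≤ s * u + t * u' := by positivity
  have hq : 0 ≤ s * v + t * v' := by positivity
  refine le_of_tendsto_of_tendsto
    ((((shift hφ hu).mul (shift hψ hv)).const_mul s).add
      (((shift hφ hu').mul (shift hψ hv')).const_mul t))
    ((shift hφ hp).mul (shift hψ hq)) ?_
  filter_upwards [self_mem_nhdsWithin] with ε hε
  have hε : 0 < ε := hε
  have h := mul_jointly_concave_of_pos hφ hψ hφ'' hφψ (u := u + ε) (u' := u' + ε) (v := v + ε)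
    (v' := v' + ε) (by linarith) (by linarith) (by linarith) (by linarith) hs ht hst
  have e : ∀ a b : ℝ, s * (a + ε) + t * (b + ε) = s * a + t * b + ε := fun a b => by
    linear_combination ε * hst
  rwa [e, e] at h

/-! ### Weak majorization and the convex hull of the rearrangements -/

/-- Abel summation. The induction removes the last, smallest weight and uses it as the new lower
bound `c`. -/
lemma mul_sum_le_sum_mul_of_antitone {n : ℕ} {d e : Fin n → ℝ} (hd : Antitone d)
    (he : ∀ j ≤ n, 0 ≤ ∑ i : Fin n with i.val < j, e i) {c : ℝ} (hc : ∀ i, c ≤ d i) :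
    c * ∑ i, e i ≤ ∑ i, d i * e i := by
  induction n generalizing c with
  | zero => simp
  | succ n ih =>
    have h1 := ih (d := fun i => d i.castSucc) (e := fun i => e i.castSucc)
      (fun i j hij => hd (Fin.castSucc_le_castSucc_iff.2 hij)) (fun j hj => by
        have := he j (by omega)
        rw [Finset.sum_filter, Fin.sum_univ_castSucc] at this
        rw [Finset.sum_filter]
        simpa [hj.not_gt] using this) (c := d (Fin.last n)) (fun i => hd (Fin.le_last _))
    have h2 : 0 ≤ ∑ i, e i := by
      have := he (n + 1) le_rfl
      rwa [Finset.filter_true_of_mem (fun i _ => i.isLt)] at this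
    refine (mul_le_mul_of_nonneg_right (hc (Fin.last n)) h2).trans ?_
    rw [Fin.sum_univ_castSucc, Fin.sum_univ_castSucc (n := n), mul_add]
    linarith

lemma incr_monotone {n : ℕ} (x : Fin n → ℝ) : Monotone (incr x) := Tuple.monotone_sort x

open scoped Pointwise in
/-- A vector that is weakly supmajorized by `y` dominates, once arranged increasingly, a convex
combination of the rearrangements of `y`. -/
theorem WeaklySupmajorizedBy.incr_mem {n : ℕ} {x y : Fin n → ℝ}
    (h : WeaklySupmajorizedBy x y) :
    incr x ∈ Ici (0 : Fin n → ℝ) +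
      convexHull ℝ (range fun σ : Equiv.Perm (Fin n) => y ∘ σ) := by
  by_contra hx
  have hfin : (range fun σ : Equiv.Perm (Fin n) => y ∘ σ).Finite := finite_range _
  obtain ⟨f, u, hfx, hf⟩ := geometric_hahn_banach_point_closed
    ((convex_Ici (0 : Fin n → ℝ)).add (convex_convexHull ℝ _))
    (isClosed_Ici.add_right_of_isCompact (hfin.isCompact_convexHull ℝ)) hx
  set c : Fin n → ℝ := fun i => f (Pi.single i 1) with hc
  have hfc : ∀ v, f v = ∑ i, c i * v i := fun v => by
    have := LinearMap.pi_apply_eq_sum_univ f.toLinearMap v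
    simp only [ContinuousLinearMap.coe_coe, smul_eq_mul] at this
    rw [this]
    refine Finset.sum_congr rfl fun i _ => ?_
    rw [mul_comm, hc]
    congr 2
    ext j
    simp [Pi.single_apply, eq_comm]
  have hperm : ∀ σ : Equiv.Perm (Fin n), y ∘ σ ∈
      convexHull ℝ (range fun σ : Equiv.Perm (Fin n) => y ∘ σ) :=
    fun σ => subset_convexHull ℝ _ ⟨σ, rfl⟩
  have hu : ∀ σ : Equiv.Perm (Fin n), u < f (y ∘ σ) := fun σ => by
    simpa using hf _ (add_mem_add (show (0 : Fin n → ℝ) ∈ Ici 0 from mem_Ici.2 le_rfl) (hperm σ))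
  -- The set is closed under adding nonnegative vectors. Were `c i < 0`, the multiple of the `i`-th
  -- unit vector chosen below, added to `y`, would bring `f` down to exactly `u`.
  have hc0 : ∀ i, 0 ≤ c i := by
    intro i
    by_contra! hci
    have hr : 0 ≤ (f y - u) / (-c i) :=
      div_nonneg (sub_nonneg.2 (hu 1).le) (neg_nonneg.2 hci.le)
    have hmem : ((f y - u) / (-c i)) • (Pi.single i 1 : Fin n → ℝ) ∈ Ici (0 : Fin n → ℝ) :=
      smul_nonneg hr (show (0 : Fin n → ℝ) ≤ Pi.single i 1 from Pi.single_nonneg.2 zero_le_one)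
    have := hf _ (add_mem_add hmem (hperm 1))
    rw [map_add, map_smul, smul_eq_mul] at this
    have h2 : (f y - u) / (-c i) * f (Pi.single i 1) = -(f y - u) := by
      change (f y - u) / (-c i) * c i = _
      field_simp [hci.ne]
    rw [h2] at this
    simp at this
  -- `σ` lists the coefficients in decreasing order. Pairing them with an increasing vector
  -- minimizes the sum over rearrangements, which bounds `f (incr x)` below; for `y` the same
  -- pairing is the value of `f` at a rearrangement, hence above `u`.
  set σ := Tuple.sort fun i => -c i with hσ
  have hd : Antitone (c ∘ σ) := fun i j hij => by
    exact neg_le_neg_iff.1 (Tuple.monotone_sort (fun i => -c i) hij)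
  have h1 : ∑ i, c (σ i) * incr x i ≤ f (incr x) := by
    have hav : Antivary (c ∘ σ) (incr x) := hd.antivary (incr_monotone x)
    rw [hfc]
    exact (hav.sum_mul_le_sum_mul_comp_perm (σ := σ)).trans_eq
      (Equiv.sum_comp σ fun k => c k * incr x k)
  have h2 : ∑ i, c (σ i) * incr y i = f (y ∘ (σ⁻¹.trans (Tuple.sort y))) := by
    rw [hfc]
    refine Eq.trans ?_ (Equiv.sum_comp σ _)
    simp [incr]
  have h3 : 0 ≤ ∑ i, (c ∘ σ) i * (incr x i - incr y i) := by
    have := mul_sum_le_sum_mul_of_antitone (e := fun i => incr x i - incr y i) hd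
      (fun j hj => by
        rw [Finset.sum_sub_distrib]
        exact sub_nonneg.2 (h j hj)) (c := 0) (fun i => hc0 _)
    simpa using this
  simp only [Function.comp_apply, mul_sub, Finset.sum_sub_distrib] at h3
  have := hu (σ⁻¹.trans (Tuple.sort y))
  linarith

lemma MajorizedBy.weaklySupmajorizedBy {n : ℕ} {x y : Fin n → ℝ} (h : MajorizedBy x y) :
    WeaklySupmajorizedBy x y := by
  intro j hj
  rcases hj.lt_or_eq with hj | rfl
  · exact h.2 j hj
  · rw [Finset.filter_true_of_mem (fun i _ => i.isLt), h.1]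

/-! ### The increasing arrangement minimizes arrangement-monotone functions -/

/-- A function of a vector that does not decrease when adjacent components in increasing order are
swapped takes, among the rearrangements of a vector, its least value at the increasing one. -/
lemma apply_incr_le_of_swap {n : ℕ} {h : (Fin n → ℝ) → ℝ≥0∞}
    (hswap : ∀ w : Fin n → ℝ, ∀ i j : Fin n, i.val + 1 = j.val → w i ≤ w j →
      h w ≤ h (w ∘ Equiv.swap i j)) (w : Fin n → ℝ) (σ : Equiv.Perm (Fin n)) :
    h (incr w) ≤ h (w ∘ σ) := by
  classical
  obtain ⟨τ₀, -, hτ₀⟩ := Finset.exists_min_image (Finset.univ : Finset (Equiv.Perm (Fin n)))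
    (fun τ => h (w ∘ τ)) ⟨1, Finset.mem_univ _⟩
  -- Among minimizers of `h`, take one maximizing `∑ k * w (τ k)`. Swapping an adjacent descent
  -- would keep it a minimizer and increase this sum, so there is no descent.
  obtain ⟨τ, hτmem, hτ⟩ := Finset.exists_max_image
    (Finset.univ.filter fun τ : Equiv.Perm (Fin n) => h (w ∘ τ) ≤ h (w ∘ τ₀))
    (fun τ => ∑ k : Fin n, (k : ℝ) * w (τ k)) ⟨τ₀, by simp⟩
  have hτ1 : h (w ∘ τ) ≤ h (w ∘ τ₀) := (Finset.mem_filter.1 hτmem).2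
  have hadj : ∀ i j : Fin n, i.val + 1 = j.val → w (τ i) ≤ w (τ j) := by
    intro i j hij
    by_contra! hlt
    have hne : i ≠ j := fun h => by subst h; omega
    set τ' : Equiv.Perm (Fin n) := τ * Equiv.swap i j with hτ'
    have h1 : h (w ∘ τ') ≤ h (w ∘ τ) := by
      have := hswap (w ∘ τ') i j hij (by simpa [hτ'] using hlt.le)
      refine this.trans (le_of_eq ?_)
      congr 1
      ext k
      simp [hτ']
    have h2 := hτ τ' (by simpa using h1.trans hτ1)
    have h3 : ∑ k : Fin n, (k : ℝ) * w (τ' k) =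
        ∑ k : Fin n, ((Equiv.swap i j k : Fin n) : ℝ) * w (τ k) := by
      rw [← Equiv.sum_comp (Equiv.swap i j)]
      simp [hτ']
    rw [h3, ← sub_nonpos, ← Finset.sum_sub_distrib, ← Finset.sum_add_sum_compl {i, j},
      Finset.sum_pair hne] at h2
    have h4 : ∑ k ∈ ({i, j} : Finset (Fin n))ᶜ,
        (((Equiv.swap i j k : Fin n) : ℝ) * w (τ k) - (k : ℝ) * w (τ k)) = 0 := by
      refine Finset.sum_eq_zero fun k hk => ?_
      simp only [Finset.mem_compl, Finset.mem_insert, Finset.mem_singleton, not_or] at hk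
      rw [Equiv.swap_apply_of_ne_of_ne hk.1 hk.2, sub_self]
    rw [h4, Equiv.swap_apply_left, Equiv.swap_apply_right] at h2
    have h5 : (j : ℝ) = (i : ℝ) + 1 := by exact_mod_cast hij.symm
    rw [h5] at h2
    linarith
  have hmono : Monotone (w ∘ τ) := by
    cases n with
    | zero => exact fun i => i.elim0
    | succ n => exact Fin.monotone_iff_le_succ.2 fun i => hadj _ _ (by simp)
  have : incr w = w ∘ τ := (Tuple.comp_sort_eq_comp_iff_monotone.2 hmono).symm
  rw [this]
  exact hτ1.trans (hτ₀ σ (Finset.mem_univ _))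

/-! ### Likelihood ratio order and swaps of weights -/

/-- The cross-multiplied form holds at all points, including those where the ratio is `0 / 0` or
infinite. -/
lemma mul_le_mul_of_monotoneOn_div {f g : ℝ → ℝ≥0}
    (h : MonotoneOn (fun x => (g x : ℝ≥0∞) / (f x : ℝ≥0∞)) {x | ¬(f x = 0 ∧ g x = 0)})
    {x y : ℝ} (hxy : x ≤ y) : g x * f y ≤ g y * f x := by
  by_cases hg : g x = 0
  · simp [hg]
  by_cases hf : f y = 0
  · simp [hf]
  have h1 := h (show x ∈ {x | ¬(f x = 0 ∧ g x = 0)} from fun h => hg h.2)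
    (show y ∈ {x | ¬(f x = 0 ∧ g x = 0)} from fun h => hf h.1) hxy
  have hf' : (f y : ℝ≥0∞) ≠ 0 := by simpa using hf
  have hfx : f x ≠ 0 := by
    intro h0
    simp only [h0, ENNReal.coe_zero, ENNReal.div_zero (ENNReal.coe_ne_zero.2 hg), top_le_iff] at h1
    exact ENNReal.div_ne_top ENNReal.coe_ne_top hf' h1
  have hfx' : (f x : ℝ≥0∞) ≠ 0 := by simpa using hfx
  simp only [← ENNReal.coe_div hf, ← ENNReal.coe_div hfx, ENNReal.coe_le_coe] at h1
  rwa [div_le_div_iff₀ (pos_iff_ne_zero.2 hfx) (pos_iff_ne_zero.2 hf)] at h1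

/-- Symmetrize across the diagonal. With `d'` the reflection of the density `d` and `S'` that of
`S`, twice the difference of the two sides is formally the integral of `(1_S' - 1_S) * (d - d')`.
Both factors are nonnegative where `z.2 ≤ z.1` and nonpositive on the other side. -/
lemma prod_withDensity_swap_le {f g : ℝ → ℝ≥0} (hf : Measurable f) (hg : Measurable g)
    [SFinite (volume.withDensity fun x => (f x : ℝ≥0∞))]
    [SFinite (volume.withDensity fun x => (g x : ℝ≥0∞))]
    (hgf : ∀ x y, x ≤ y → g x * f y ≤ g y * f x) {p q : ℝ} (hpq : p ≤ q) (t : ℝ) :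
    ((volume.withDensity fun x => (g x : ℝ≥0∞)).prod (volume.withDensity fun x => (f x : ℝ≥0∞)))
        {z | t < p * z.1 + q * z.2} ≤
      ((volume.withDensity fun x => (g x : ℝ≥0∞)).prod (volume.withDensity fun x => (f x : ℝ≥0∞)))
        {z | t < q * z.1 + p * z.2} := by
  rw [prod_withDensity hg.coe_nnreal_ennreal hf.coe_nnreal_ennreal]
  have hS : MeasurableSet {z : ℝ × ℝ | t < p * z.1 + q * z.2} :=
    measurableSet_lt (by fun_prop) (by fun_prop)
  have hS' : MeasurableSet {z : ℝ × ℝ | t < q * z.1 + p * z.2} :=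
    measurableSet_lt (by fun_prop) (by fun_prop)
  rw [withDensity_apply _ hS, withDensity_apply _ hS', ← lintegral_indicator hS,
    ← lintegral_indicator hS']
  set S := {z : ℝ × ℝ | t < p * z.1 + q * z.2}
  set S' := {z : ℝ × ℝ | t < q * z.1 + p * z.2}
  set d : ℝ × ℝ → ℝ≥0∞ := fun z => (g z.1 : ℝ≥0∞) * f z.2
  set d' : ℝ × ℝ → ℝ≥0∞ := fun z => (g z.2 : ℝ≥0∞) * f z.1
  have hd : Measurable d := by fun_prop
  have hd' : Measurable d' := by fun_prop
  have e1 : ∫⁻ z, S.indicator d z ∂(volume.prod volume) =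
      ∫⁻ z, S'.indicator d' z ∂(volume.prod volume) := by
    rw [← lintegral_prod_swap]
    refine lintegral_congr fun z => ?_
    simp only [indicator, S, S', d, d', mem_ofPred_eq, Prod.fst_swap, Prod.snd_swap, add_comm]
  have e2 : ∫⁻ z, S'.indicator d z ∂(volume.prod volume) =
      ∫⁻ z, S.indicator d' z ∂(volume.prod volume) := by
    rw [← lintegral_prod_swap]
    refine lintegral_congr fun z => ?_
    simp only [indicator, S, S', d, d', mem_ofPred_eq, Prod.fst_swap, Prod.snd_swap, add_comm]
  have key : ∫⁻ z, (S.indicator d z + S'.indicator d' z) ∂(volume.prod volume) ≤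
      ∫⁻ z, (S'.indicator d z + S.indicator d' z) ∂(volume.prod volume) := by
    refine lintegral_mono fun z => ?_
    rcases le_total z.2 z.1 with hz | hz
    · have hdd : d' z ≤ d z := by
        have := hgf z.2 z.1 hz
        simp only [d, d']
        exact_mod_cast this
      have hsub : z ∈ S → z ∈ S' := fun (h : t < p * z.1 + q * z.2) => by
        change t < q * z.1 + p * z.2
        nlinarith [mul_nonneg (sub_nonneg.2 hpq) (sub_nonneg.2 hz)]
      by_cases h1 : z ∈ S
      · simp [h1, hsub h1]
      · by_cases h2 : z ∈ S' <;> simp [h1, h2, hdd]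
    · have hdd : d z ≤ d' z := by
        have := hgf z.1 z.2 hz
        simp only [d, d']
        exact_mod_cast this
      have hsub : z ∈ S' → z ∈ S := fun (h : t < q * z.1 + p * z.2) => by
        change t < p * z.1 + q * z.2
        nlinarith [mul_nonneg (sub_nonneg.2 hpq) (sub_nonneg.2 hz)]
      by_cases h1 : z ∈ S'
      · simp [h1, hsub h1]
      · by_cases h2 : z ∈ S <;> simp [h1, h2, hdd]
  rw [lintegral_add_left (hd.indicator hS), lintegral_add_left (hd.indicator hS'), ← e1, ← e2,
    ← two_mul, ← two_mul] at key
  exact (ENNReal.mul_le_mul_iff_right (by norm_num) (by norm_num)).1 key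

/-- The remaining terms sum to some `R` independent of `(X i, X j)`. Conditioning on `R = r` reduces
to the two-variable inequality at level `t - r`. -/
lemma measure_lt_sum_swap_le {Ω : Type*} [MeasurableSpace Ω] {P : Measure Ω}
    [IsProbabilityMeasure P] {n : ℕ} {X : Fin n → Ω → ℝ} (hXmeas : ∀ i, AEMeasurable (X i) P)
    (hXindep : iIndepFun X P) {i j : Fin n} (hij : i ≠ j) (hlr : LrLE (X j) (X i) P)
    (w : Fin n → ℝ) (hw : w i ≤ w j) (t : ℝ) :
    P {ω | t < ∑ k, w k * X k ω} ≤ P {ω | t < ∑ k, (w ∘ Equiv.swap i j) k * X k ω} := by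
  classical
  obtain ⟨f, g, hf, hg, hfg⟩ := hlr
  set C : Finset (Fin n) := {i, j}ᶜ with hC
  set R : Ω → ℝ := fun ω => ∑ k ∈ C, w k * X k ω with hR
  have hRm : AEMeasurable R P := by
    rw [hR]
    exact Finset.aemeasurable_fun_sum _ fun k _ => (hXmeas k).const_mul _
  have hpair : AEMeasurable (fun ω => (X i ω, X j ω)) P := (hXmeas i).prodMk (hXmeas j)
  have hind1 : IndepFun (X i) (X j) P := hXindep.indepFun hij
  have hind2 : IndepFun (fun ω => (X i ω, X j ω)) R P := by
    have h := hXindep.indepFun_finset₀ {i, j} C (by rw [hC]; exact disjoint_compl_right) hXmeas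
    have h' := h.comp
      (φ := fun v : ({i, j} : Finset (Fin n)) → ℝ => (v ⟨i, by simp⟩, v ⟨j, by simp⟩))
      (ψ := fun v : C → ℝ => ∑ k : C, w k * v k) (by fun_prop) (by fun_prop)
    have hRe : R = (fun v : C → ℝ => ∑ k : C, w k * v k) ∘ fun ω (k : C) => X k ω := by
      ext ω
      simp only [hR, Function.comp_apply]
      exact (Finset.sum_coe_sort C fun k => w k * X k ω).symm
    rw [hRe]
    exact h'
  have hlaw : P.map (fun ω => ((X i ω, X j ω), R ω)) =
      ((volume.withDensity fun x => (g x : ℝ≥0∞)).prod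
        (volume.withDensity fun x => (f x : ℝ≥0∞))).prod (P.map R) := by
    rw [(indepFun_iff_map_prod_eq_prod_map_map hpair hRm).1 hind2,
      (indepFun_iff_map_prod_eq_prod_map_map (hXmeas i) (hXmeas j)).1 hind1, hg.map_eq, hf.map_eq]
  have hSm : ∀ p q : ℝ, MeasurableSet {z : (ℝ × ℝ) × ℝ | t < p * z.1.1 + q * z.1.2 + z.2} :=
    fun p q => measurableSet_lt (by fun_prop) (by fun_prop)
  have hprob : ∀ p q : ℝ, P {ω | t < p * X i ω + q * X j ω + R ω} =
      (((volume.withDensity fun x => (g x : ℝ≥0∞)).prod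
        (volume.withDensity fun x => (f x : ℝ≥0∞))).prod (P.map R))
        {z | t < p * z.1.1 + q * z.1.2 + z.2} := by
    intro p q
    rw [← hlaw, Measure.map_apply_of_aemeasurable (hpair.prodMk hRm) (hSm p q)]
    rfl
  have hsum : ∀ v : Fin n → ℝ, (∀ k ∈ C, v k = w k) → ∀ ω,
      ∑ k, v k * X k ω = v i * X i ω + v j * X j ω + R ω := by
    intro v hv ω
    rw [← Finset.sum_add_sum_compl {i, j}, Finset.sum_pair hij]
    congr 1
    exact Finset.sum_congr rfl fun k hk => by rw [hv k hk]
  have hswapC : ∀ k ∈ C, (w ∘ Equiv.swap i j) k = w k := by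
    intro k hk
    simp only [hC, Finset.mem_compl, Finset.mem_insert, Finset.mem_singleton, not_or] at hk
    simp [Equiv.swap_apply_of_ne_of_ne hk.1 hk.2]
  simp only [hsum w (fun _ _ => rfl), hsum _ hswapC]
  simp only [Function.comp_apply, Equiv.swap_apply_left, Equiv.swap_apply_right]
  rw [hprob, hprob, Measure.prod_apply_symm (hSm _ _), Measure.prod_apply_symm (hSm _ _)]
  refine lintegral_mono fun r => ?_
  have h := prod_withDensity_swap_le hf.measurable hg.measurable
    (fun x y hxy => mul_le_mul_of_monotoneOn_div hfg hxy) hw (t - r)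
  simpa only [preimage_ofPred_eq, sub_lt_iff_lt_add] using h

/-! ### Tail probabilities of weighted sums are quasi-concave in the transformed weights -/

/-- The set of nonnegative vectors at which the weighted sum of transforms exceeds `t`. -/
def tailSet {n : ℕ} (φ ψ : ℝ → ℝ) (t : ℝ) (α : Fin n → ℝ) : Set (Fin n → ℝ) :=
  {y | (∀ i, 0 ≤ y i) ∧ t < ∑ i, φ (α i) * ψ (y i)}

lemma measurableSet_tailSet {n : ℕ} (φ : ℝ → ℝ) {ψ : ℝ → ℝ} (hψ : IsMonotoneTransform ψ) (t : ℝ)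
    (α : Fin n → ℝ) : MeasurableSet (tailSet φ ψ t α) := by
  -- `ψ` is controlled only on the half line; this extension agrees with it there and is continuous
  -- everywhere.
  have hcont : Continuous fun x : ℝ => ψ (max x 0) :=
    hψ.continuousOn.comp_continuous (by fun_prop) fun x => le_max_right x 0
  have heq : tailSet φ ψ t α =
      {y | ∀ i, 0 ≤ y i} ∩ {y | t < ∑ i, φ (α i) * ψ (max (y i) 0)} := by
    ext y
    refine and_congr_right fun hy => ?_
    simp only [max_eq_left (hy _), mem_ofPred_eq]
  rw [heq]
  refine MeasurableSet.inter ?_ (measurableSet_lt measurable_const ?_)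
  · rw [ofPred_forall]
    exact MeasurableSet.iInter fun i => measurableSet_le measurable_const (measurable_pi_apply i)
  · exact Finset.measurable_fun_sum _ fun i _ =>
      (hcont.measurable.comp (measurable_pi_apply i)).const_mul _

lemma convex_setOf_le_measure_tailSet {n : ℕ} {φ ψ : ℝ → ℝ} (hφ : IsMonotoneTransform φ)
    (hψ : IsMonotoneTransform ψ) (hφ'' : ∀ u, 0 < u → deriv (deriv φ) u ≤ 0)
    (hφψ : ∀ u v : ℝ, 0 < u → 0 < v →
      (deriv φ u * deriv ψ v) ^ 2 ≤ deriv (deriv φ) u * deriv (deriv ψ) v * φ u * ψ v)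
    {μ : Measure (Fin n → ℝ)} (hμ : PrekopaLeindler μ) (t : ℝ) {m : ℝ≥0∞} (hm : m ≠ ∞) :
    Convex ℝ {α : Fin n → ℝ | (∀ i, 0 ≤ α i) ∧ m ≤ μ (tailSet φ ψ t α)} := by
  rw [convex_iff_forall_pos]
  rintro α ⟨hα, hmα⟩ β ⟨hβ, hmβ⟩ r s hr hs hrs
  refine ⟨fun i => add_nonneg (mul_nonneg hr.le (hα i)) (mul_nonneg hs.le (hβ i)), ?_⟩
  -- The splitting `m = m ^ r * m ^ s` used at the end needs `m` nonzero and finite.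
  rcases eq_or_ne m 0 with rfl | hm0
  · exact zero_le
  have hmeas := measurableSet_tailSet (n := n) φ hψ t
  have hsub : ∀ x ∈ tailSet φ ψ t α, ∀ y ∈ tailSet φ ψ t β,
      r • x + s • y ∈ tailSet φ ψ t (r • α + s • β) := by
    rintro x ⟨hx, hxt⟩ y ⟨hy, hyt⟩
    refine ⟨fun i => add_nonneg (mul_nonneg hr.le (hx i)) (mul_nonneg hs.le (hy i)), ?_⟩
    calc t = r * t + s * t := by rw [← add_mul, hrs, one_mul]
      _ < r * ∑ i, φ (α i) * ψ (x i) + s * ∑ i, φ (β i) * ψ (y i) :=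
        add_lt_add (mul_lt_mul_of_pos_left hxt hr) (mul_lt_mul_of_pos_left hyt hs)
      _ ≤ _ := by
        rw [Finset.mul_sum, Finset.mul_sum, ← Finset.sum_add_distrib]
        exact Finset.sum_le_sum fun i _ => mul_jointly_concave hφ hψ hφ'' hφψ (hα i) (hβ i) (hx i)
          (hy i) hr.le hs.le hrs
  have h := hμ r s hr hs hrs ((tailSet φ ψ t α).indicator 1) ((tailSet φ ψ t β).indicator 1)
    ((tailSet φ ψ t (r • α + s • β)).indicator 1) (measurable_one.indicator (hmeas _))
    (measurable_one.indicator (hmeas _)) (measurable_one.indicator (hmeas _)) (fun x y => by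
      by_cases hx : x ∈ tailSet φ ψ t α
      · by_cases hy : y ∈ tailSet φ ψ t β
        · simp [hx, hy, hsub x hx y hy]
        · simp [hy, hs]
      · simp [hx, hr])
  rw [lintegral_indicator_one (hmeas _), lintegral_indicator_one (hmeas _),
    lintegral_indicator_one (hmeas _)] at h
  refine le_trans ?_ h
  rw [← rpow_mul_rpow_self hm0 hm hrs]
  gcongr

/-! ### Passing from `X` to `inv ψ (X)` -/

section TransformedVariables

variable {Ω : Type*} [MeasurableSpace Ω] {P : Measure Ω}

lemma inv_apply {ψ : ℝ → ℝ} (hψ : IsMonotoneTransform ψ) {x : ℝ} (hx : 0 ≤ x) :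
    inv ψ (ψ x) = x :=
  hψ.injOn.leftInvOn_invFunOn hx

lemma inv_nonneg_of_mem {ψ : ℝ → ℝ} {x : ℝ} (hx : x ∈ ψ '' Ici 0) : 0 ≤ inv ψ x :=
  Function.invFunOn_mem hx

lemma apply_inv {ψ : ℝ → ℝ} {x : ℝ} (hx : x ∈ ψ '' Ici 0) : ψ (inv ψ x) = x :=
  Function.invFunOn_eq hx

/-- Outside the image of `ψ`, `inv ψ` is arbitrary. On the image, an interval carrying the law of
`X`, it is monotone. -/
lemma aemeasurable_inv {ψ : ℝ → ℝ} (hψ : IsMonotoneTransform ψ)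
    (hmono : StrictMonoOn ψ (Ici 0)) {X : Ω → ℝ} (hX : AEMeasurable X P)
    (hXψ : ∀ᵐ ω ∂P, X ω ∈ ψ '' Ici 0) : AEMeasurable (inv ψ) (P.map X) := by
  have hord : (ψ '' Ici 0).OrdConnected := (isPreconnected_Ici.image ψ hψ.continuousOn).ordConnected
  have hmeas : MeasurableSet (ψ '' Ici 0) := hord.measurableSet
  have hinv : MonotoneOn (inv ψ) (ψ '' Ici 0) := by
    rintro _ ⟨p, hp, rfl⟩ _ ⟨q, hq, rfl⟩ hpq
    rw [inv_apply hψ hp, inv_apply hψ hq]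
    exact (hmono.le_iff_le hp hq).1 hpq
  have h := aemeasurable_restrict_of_monotoneOn (μ := P.map X) hmeas hinv
  have hae : ∀ᵐ x ∂(P.map X), x ∈ ψ '' Ici 0 := (ae_map_iff hX hmeas).2 hXψ
  rwa [Measure.restrict_eq_self_of_ae_mem hae] at h

lemma measure_sum_transform_eq [IsProbabilityMeasure P] {n : ℕ} {X : Fin n → Ω → ℝ}
    (hXmeas : ∀ i, AEMeasurable (X i) P) (hXindep : iIndepFun X P) {ψ : ℝ → ℝ}
    (hψ : IsMonotoneTransform ψ) (hmono : StrictMonoOn ψ (Ici 0))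
    (hXψ : ∀ i, ∀ᵐ ω ∂P, X i ω ∈ ψ '' Ici 0) (φ : ℝ → ℝ) (t : ℝ) (α : Fin n → ℝ) :
    P {ω | t < ∑ i, φ (α i) * X i ω} =
      Measure.pi (fun i => P.map fun ω => inv ψ (X i ω)) (tailSet φ ψ t α) := by
  have hinv := fun i => aemeasurable_inv hψ hmono (hXmeas i) (hXψ i)
  have hY : ∀ i, AEMeasurable (fun ω => inv ψ (X i ω)) P :=
    fun i => (hinv i).comp_aemeasurable (hXmeas i)
  have hYindep : iIndepFun (fun i ω => inv ψ (X i ω)) P :=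
    hXindep.comp₀ (fun _ => inv ψ) hXmeas hinv
  rw [← (iIndepFun_iff_map_fun_eq_pi_map hY).1 hYindep,
    Measure.map_apply_of_aemeasurable (aemeasurable_pi_lambda _ hY) (measurableSet_tailSet φ hψ t α)]
  refine measure_congr ?_
  filter_upwards [ae_all_iff.2 hXψ] with ω hω
  refine propext ?_
  change t < ∑ i, φ (α i) * X i ω ↔
    (∀ i, 0 ≤ inv ψ (X i ω)) ∧ t < ∑ i, φ (α i) * ψ (inv ψ (X i ω))
  simp only [apply_inv (hω _), inv_nonneg_of_mem (hω _), implies_true, true_and]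

lemma HasLogConcaveDensity.prekopaLeindler {X : Ω → ℝ} (h : HasLogConcaveDensity X P) :
    PrekopaLeindler (P.map X) := by
  obtain ⟨f, hf, hlc⟩ := h
  rw [hf.map_eq]
  exact prekopaLeindler_volume.withDensity hf.measurable hlc

end TransformedVariables

/-! ### Comparison of the weighted sums -/

lemma incr_comp_of_strictMonoOn {n : ℕ} {φ : ℝ → ℝ} (hφ : StrictMonoOn φ (Ici 0))
    {a : Fin n → ℝ} (ha : ∀ i, a i ∈ φ '' Ici 0) :
    (fun i => φ (incr (fun i => inv φ (a i)) i)) = incr a := by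
  have h : (fun i => φ (incr (fun i => inv φ (a i)) i)) =
      a ∘ Tuple.sort fun i => inv φ (a i) := by
    ext i
    simp [incr, apply_inv (ha _)]
  rw [h, incr, Tuple.comp_sort_eq_comp_iff_monotone, ← h]
  intro i j hij
  exact hφ.monotoneOn (inv_nonneg_of_mem (ha _)) (inv_nonneg_of_mem (ha _))
    (incr_monotone (fun i => inv φ (a i)) hij)

/-- The weakly supmajorized case, from which the others follow. -/
theorem stLE_of_weaklySupmajorizedBy {Ω : Type*} [MeasurableSpace Ω] {P : Measure Ω}
    [IsProbabilityMeasure P] {n : ℕ} {X : Fin n → Ω → ℝ}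
    (hXmeas : ∀ i, AEMeasurable (X i) P) (hXnonneg : ∀ i, ∀ᵐ ω ∂P, 0 ≤ X i ω)
    (hXindep : iIndepFun X P) (hXlr : ∀ i j : Fin n, i.val + 1 = j.val → LrLE (X j) (X i) P)
    {φ ψ : ℝ → ℝ} (hφ : IsMonotoneTransform φ) (hψ : IsMonotoneTransform ψ)
    (hφ'' : ∀ u : ℝ, 0 < u → deriv (deriv φ) u ≤ 0)
    (hφψ : ∀ u v : ℝ, 0 < u → 0 < v →
      (deriv φ u * deriv ψ v) ^ 2 ≤ deriv (deriv φ) u * deriv (deriv ψ) v * φ u * ψ v)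
    (hXψ : ∀ i, ∀ᵐ ω ∂P, X i ω ∈ ψ '' Ici 0)
    (hXlogconc : ∀ i, HasLogConcaveDensity (fun ω => inv ψ (X i ω)) P)
    {a b : Fin n → ℝ} (ha : ∀ i, a i ∈ φ '' Ici 0) (hb : ∀ i, b i ∈ φ '' Ici 0)
    (hab : WeaklySupmajorizedBy (fun i => inv φ (b i)) (fun i => inv φ (a i))) :
    StLE (fun ω => ∑ i, incr a i * X i ω) (fun ω => ∑ i, incr b i * X i ω) P := by
  intro t
  have hφm := hφ.strictMonoOn_of_deriv2_nonpos hφ''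
  have hψm := hψ.strictMonoOn_of_deriv2_nonpos fun v hv => hφ.deriv2_nonpos_of_det hψ hφ'' hφψ hv
  have hYprob : ∀ i, IsProbabilityMeasure (P.map fun ω => inv ψ (X i ω)) := fun i =>
    Measure.isProbabilityMeasure_map
      ((aemeasurable_inv hψ hψm (hXmeas i) (hXψ i)).comp_aemeasurable (hXmeas i))
  have hlaw := measure_sum_transform_eq hXmeas hXindep hψ hψm hXψ φ t
  have hconv := convex_setOf_le_measure_tailSet hφ hψ hφ'' hφψ
    (PrekopaLeindler.pi fun i => (hXlogconc i).prekopaLeindler) t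
    (measure_ne_top P {ω | t < ∑ i, incr a i * X i ω})
  -- The sorted preimages of `b` are `z + γ`, with `z ≥ 0` and `γ` in the hull of the rearranged
  -- preimages of `a`.
  obtain ⟨z, hz, γ, hγ, hzγ⟩ := hab.incr_mem
  -- The superlevel set is taken at the tail of the increasing arrangement of `a`, so it contains
  -- every rearrangement and hence `γ`.
  have hγ' := convexHull_min (by
    rintro _ ⟨σ, rfl⟩
    refine ⟨fun i => inv_nonneg_of_mem (ha _), ?_⟩
    rw [← hlaw]
    simp only [Function.comp_apply, apply_inv (ha _)]
    exact apply_incr_le_of_swap (h := fun w => P {ω | t < ∑ i, w i * X i ω})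
      (fun w i j hij hw => measure_lt_sum_swap_le hXmeas hXindep (fun h => by subst h; omega)
        (hXlr i j hij) w hw t) a σ) hconv hγ
  have htail : P {ω | t < ∑ i, incr a i * X i ω} ≤ P {ω | t < ∑ i, incr b i * X i ω} := by
    refine hγ'.2.trans ?_
    rw [← hlaw, ← incr_comp_of_strictMonoOn hφm hb]
    refine measure_mono_ae ?_
    filter_upwards [ae_all_iff.2 hXnonneg] with ω hω hlt
    refine lt_of_lt_of_le (show t < ∑ i, φ (γ i) * X i ω from hlt)
      (Finset.sum_le_sum fun i _ => mul_le_mul_of_nonneg_right ?_ (hω i))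
    have hzi : 0 ≤ z i := hz i
    have hle : γ i ≤ incr (fun i => inv φ (b i)) i := by
      rw [← hzγ]
      exact le_add_of_nonneg_left hzi
    exact hφm.monotoneOn (hγ'.1 i) ((hγ'.1 i).trans hle) hle
  have hcompl : ∀ w : Fin n → ℝ, P {ω | ∑ i, w i * X i ω ≤ t} =
      1 - P {ω | t < ∑ i, w i * X i ω} := fun w => by
    have hm : AEMeasurable (fun ω => ∑ i, w i * X i ω) P :=
      Finset.aemeasurable_fun_sum _ fun i _ => (hXmeas i).const_mul _
    rw [← prob_compl_eq_one_sub₀ (nullMeasurableSet_lt aemeasurable_const hm)]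
    congr 1
    ext ω
    simp
  rw [hcompl, hcompl]
  exact tsub_le_tsub_left htail 1

end LinComb

theorem theorem4p2 {Ω : Type*} [MeasurableSpace Ω] (P : Measure Ω) [IsProbabilityMeasure P]
    (n : ℕ) (X : Fin n → Ω → ℝ)
    (hXmeas : ∀ i, AEMeasurable (X i) P)
    (hXnonneg : ∀ i, ∀ᵐ ω ∂P, 0 ≤ X i ω)
    (hXindep : iIndepFun X P)
    (hXlr : ∀ i j : Fin n, i.val + 1 = j.val → LinComb.LrLE (X j) (X i) P)
    (φ ψ : ℝ → ℝ)
    (hφ : LinComb.IsMonotoneTransform φ) (hψ : LinComb.IsMonotoneTransform ψ)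
    (hφ'' : ∀ u : ℝ, 0 < u → deriv (deriv φ) u ≤ 0)
    (hφψ : ∀ u v : ℝ, 0 < u → 0 < v →
      (deriv φ u * deriv ψ v) ^ 2 ≤ deriv (deriv φ) u * deriv (deriv ψ) v * φ u * ψ v)
    (hXψ : ∀ i, ∀ᵐ ω ∂P, X i ω ∈ ψ '' Ici 0)
    (hXlogconc : ∀ i, LinComb.HasLogConcaveDensity (fun ω => LinComb.inv ψ (X i ω)) P)
    (a b : Fin n → ℝ)
    (ha : ∀ i, a i ∈ φ '' Ici 0) (hb : ∀ i, b i ∈ φ '' Ici 0) :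
    (LinComb.MajorizedBy (fun i => LinComb.inv φ (b i)) (fun i => LinComb.inv φ (a i)) →
      LinComb.StLE (fun ω => ∑ i, LinComb.incr a i * X i ω)
        (fun ω => ∑ i, LinComb.incr b i * X i ω) P) ∧
    (StrictMonoOn φ (Ici 0) →
      LinComb.WeaklySupmajorizedBy (fun i => LinComb.inv φ (b i))
        (fun i => LinComb.inv φ (a i)) →
      LinComb.StLE (fun ω => ∑ i, LinComb.incr a i * X i ω)
        (fun ω => ∑ i, LinComb.incr b i * X i ω) P) ∧
    (StrictAntiOn φ (Ici 0) →
      LinComb.WeaklySubmajorizedBy (fun i => LinComb.inv φ (b i))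
        (fun i => LinComb.inv φ (a i)) →
      LinComb.StLE (fun ω => ∑ i, LinComb.incr a i * X i ω)
        (fun ω => ∑ i, LinComb.incr b i * X i ω) P) := by
  have weak := fun h => LinComb.stLE_of_weaklySupmajorizedBy hXmeas hXnonneg hXindep hXlr hφ hψ
    hφ'' hφψ hXψ hXlogconc ha hb h
  refine ⟨fun h => weak h.weaklySupmajorizedBy, fun _ => weak, fun hanti _ => ?_⟩
  -- A nonnegative concave strictly monotone function on the half line is increasing.
  have h1 := hφ.strictMonoOn_of_deriv2_nonpos hφ'' self_mem_Ici (mem_Ici.2 zero_le_one) zero_lt_one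
  exact absurd h1 (hanti self_mem_Ici (mem_Ici.2 zero_le_one) zero_lt_one).not_gt
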